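/- Let $f$ be an entire function in the Laguerre–Pólya class with $f(0)=1$, i.e. $$f(z)=e^{cz-\frac{\sigma^2}{2}z^2}\prod_{j=1}^{N}\Bigl(1-\frac{z}{x_j}\Bigr)e^{z/x_j},$$ where $c,\sigma\in\mathbb{R}$, $N\in\{0,1,2,\dots\}\cup\{\infty\}$, and the $x_j\in\mathbb{R}\setminus\{0\}$ (repetitions allowed) satisfy $\sum_{j=1}^{N}x_j^{-2}<\infty$. Write $f(z)=\sum_{k\ge 0}\frac{\gamma_k}{k!}z^k$, let $D=\frac{d}{dz}$, and for each integer $d\ge 1$ let $$A_{d,f}(z)=f(D)z^d=\sum_{k=0}^{d}\gamma_k\binom{d}{k}z^{d-k},\qquad \tilde A_d(z)=d^{-d}A_{d,f}(dz),$$ so that the roots of $\tilde A_d$ are those of $A_{d,f}$ divided by $d$. Then all roots of $\tilde A_d$ are real. Let $\mu_{\tilde A_d}=\frac1d\sum\delta_r$ be its empirical root measure, where the sum runs over the $d$ roots $r$ of $\tilde A_d$, counted with multiplicity. As $d\to\infty$, the finite measures $d\,t^2\,d\mu_{\tilde A_d}(t)$ on $\mathbb{R}$ converge weakly to the finite measure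 $$G_f=\sigma^2\delta_0+\sum_{j=1}^{N}\frac{1}{x_j^{2}}\,\delta_{1/x_j},$$ that is, for every bounded continuous function $g:\mathbb{R}\to\mathbb{R}$, $$\lim_{d\to\infty}\int_{\mathbb{R}} g(t)\,d\,t^2\,d\mu_{\tilde A_d}(t)=\int_{\mathbb{R}} g\,dG_f .$$ -/

import Mathlib

open Filter Topology MeasureTheory Polynomial
open scoped ENNReal BoundedContinuousFunction Nat

/-- The genus-one factors `(1 - z / x_i) e^{z / x_i}` are multipliable as soon as `∑ x_i⁻²`
converges, so that the infinite product below is a genuine (unconditional) product. -/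
theorem multipliable_weierstrassFactor {ι : Type*} (x : ι → ℝ)
    (hx : Summable fun i => ((x i) ^ 2)⁻¹) (z : ℂ) :
    Multipliable fun i => (1 - z / (x i : ℂ)) * Complex.exp (z / (x i : ℂ)) := by
  have hsq : Summable fun i => ‖z / (x i : ℂ)‖ ^ 2 := by
    refine (hx.mul_left (‖z‖ ^ 2)).congr fun i => ?_
    rw [norm_div, div_pow, Complex.norm_real, Real.norm_eq_abs, sq_abs, div_eq_mul_inv]
  have key : Summable fun i =>
      ‖(1 - z / (x i : ℂ)) * Complex.exp (z / (x i : ℂ)) - 1‖ := by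
    refine Summable.of_norm_bounded_eventually (g := fun i => 3 * ‖z / (x i : ℂ)‖ ^ 2)
      (hsq.mul_left 3) ?_
    have h1 : ∀ᶠ i in cofinite, ‖z / (x i : ℂ)‖ ^ 2 < 1 :=
      hsq.tendsto_cofinite_zero.eventually (gt_mem_nhds one_pos)
    filter_upwards [h1] with i hi
    set w : ℂ := z / (x i : ℂ)
    have hw : ‖w‖ ≤ 1 := by nlinarith [norm_nonneg w]
    have e : (1 - w) * Complex.exp w - 1
        = (1 - w) * (Complex.exp w - 1 - w) - w ^ 2 := by ring
    have h2 : ‖Complex.exp w - 1 - w‖ ≤ ‖w‖ ^ 2 := Complex.norm_exp_sub_one_sub_id_le hw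
    have h3 : ‖1 - w‖ ≤ 2 := by
      have := norm_sub_le (1 : ℂ) w
      rw [norm_one] at this
      linarith
    rw [norm_norm, e]
    calc ‖(1 - w) * (Complex.exp w - 1 - w) - w ^ 2‖
        ≤ ‖1 - w‖ * ‖Complex.exp w - 1 - w‖ + ‖w‖ ^ 2 := by
          have := norm_sub_le ((1 - w) * (Complex.exp w - 1 - w)) (w ^ 2)
          rwa [norm_mul, norm_pow] at this
      _ ≤ 2 * ‖w‖ ^ 2 + ‖w‖ ^ 2 := by gcongr
      _ = 3 * ‖w‖ ^ 2 := by ring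
  have := multipliable_one_add_of_summable key
  refine this.congr fun i => ?_
  ring

/-- `f` belongs to the Laguerre–Pólya class, with the representation
`f(z) = C z^m e^{c z - σ² z² / 2} ∏_i (1 - z / x_i) e^{z / x_i}`, where the real nonzero numbers
`x_i` (a finite or countable multiset, given as a family) satisfy `∑ x_i⁻² < ∞`. -/
structure LaguerrePolyaRep {ι : Type*} (f : ℂ → ℂ) (C c σ : ℝ) (m : ℕ) (x : ι → ℝ) : Prop where
  ne_zero : ∀ i, x i ≠ 0
  summable : Summable fun i => ((x i) ^ 2)⁻¹
  eq_prod : ∀ z : ℂ, f z = (C : ℂ) * z ^ m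
    * Complex.exp ((c : ℂ) * z - (σ : ℂ) ^ 2 / 2 * z ^ 2)
    * ∏' i, (1 - z / (x i : ℂ)) * Complex.exp (z / (x i : ℂ))

/-- The operator `f(D) = ∑ₖ (γₖ / k!) Dᵏ` on polynomials, where `f(z) = ∑ₖ (γₖ / k!) zᵏ` is the
Taylor series of `f` at `0`, so `γₖ = f⁽ᵏ⁾(0)`; the terms with `k > deg p` vanish on `p`. -/
noncomputable def applyDiff (f : ℂ → ℂ) (p : ℂ[X]) : ℂ[X] :=
  ∑ k ∈ Finset.range (p.natDegree + 1),
    Polynomial.C (iteratedDeriv k f 0 / (k ! : ℂ)) * derivative^[k] p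

/-- The Appell polynomial `A_{d,f}(z) = f(D) z^d`. -/
noncomputable def appellPoly (f : ℂ → ℂ) (d : ℕ) : ℂ[X] :=
  applyDiff f (X ^ d)

/-- The dilation `(𝒟_α p)(z) = α^{deg p} p(z / α)`, which multiplies the roots by `α`. -/
noncomputable def dilatePoly (α : ℂ) (p : ℂ[X]) : ℂ[X] :=
  Polynomial.C (α ^ p.natDegree) * p.comp (Polynomial.C α⁻¹ * X)

/-- The polynomial `Ã_d = 𝒟_{1/d} A_{d,f}`. -/
noncomputable def scaledAppellPoly (f : ℂ → ℂ) (d : ℕ) : ℂ[X] :=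
  dilatePoly (1 / (d : ℂ)) (appellPoly f d)

/-- The empirical root measure `μ_p = (1 / deg p) ∑ δ_{root}` of a polynomial all of whose roots
are real, the sum being over the roots with multiplicity; it is a measure on the real line. -/
noncomputable def empiricalRootMeasure (p : ℂ[X]) : Measure ℝ :=
  (p.natDegree : ℝ≥0∞)⁻¹ • (p.roots.map fun z => Measure.dirac z.re).sum

/-- The measure `d t² dμ_{Ã_d}(t)`. -/
noncomputable def appellRootMeasure (f : ℂ → ℂ) (d : ℕ) : Measure ℝ :=
  (empiricalRootMeasure (scaledAppellPoly f d)).withDensity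
    fun t => ENNReal.ofReal ((d : ℝ) * t ^ 2)

/-- The measure `G_f = σ² δ_0 + ∑_i x_i⁻² δ_{1 / x_i}`. -/
noncomputable def limitRootMeasure {ι : Type*} (σ : ℝ) (x : ι → ℝ) : Measure ℝ :=
  ENNReal.ofReal (σ ^ 2) • Measure.dirac 0
    + Measure.sum fun i => ENNReal.ofReal (((x i) ^ 2)⁻¹) • Measure.dirac (x i)⁻¹

/-- Weak convergence of finite Borel measures on the real line: convergence of the integrals of
all bounded continuous functions. -/
def WeaklyConverges (ρ : ℕ → Measure ℝ) (G : Measure ℝ) : Prop :=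
  (∀ d, IsFiniteMeasure (ρ d)) ∧ IsFiniteMeasure G ∧
    ∀ g : ℝ →ᵇ ℝ, Tendsto (fun d => ∫ t, g t ∂(ρ d)) atTop (𝓝 (∫ t, g t ∂G))

/-!
Throughout, functions are replaced by their Taylor series at `0`, viewed as formal power series,
and convergence means convergence of each coefficient. If `r` runs over the roots of the scaled
Appell polynomial `Ã_d`, then the coefficient of `X ^ k` in `∏ (1 - r X)` is
`(γₖ / k!) · d (d - 1) ⋯ (d - k + 1) / d ^ k`, which tends to `γₖ / k!`; so `∏ (1 - r X)` converges
to the series of `f` (`tendsto_coeff_rootSeries_scaledAppellPoly`). By Newton's identities the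
logarithmic derivative `F' / F` is a continuous function of a series `F` with constant coefficient
`1` (`IsLogDeriv.tendsto_logDeriv`). The coefficients of the logarithmic derivative of
`∏ (1 - r X)` are the negatives of the power sums of the `r`; those of `f` are read off from its
product representation, and from degree `1` on they are the negatives of the moments of
`σ² δ₀ + ∑ xᵢ⁻² δ_{1 / xᵢ}` (`LaguerrePolyaRep.exists_isLogDeriv`). So the power sums `∑ r ^ (k + 2)`,
which are the moments of `d t² dμ_{Ã_d}(t) = ∑ r² δ_r`, converge to the moments of the limit
measure. The convergent second power sum also confines all roots to a bounded interval, where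
convergence of moments implies weak convergence (`tendsto_integral_of_tendsto_moments`).

The reality of the roots comes from the operators `F(D)`. For real `r` the operator `1 - r D`
preserves real-rootedness, and the class of series `F` such that `F(D)` does so is closed under
products and limits, because a monic polynomial of degree `d` is real-rooted if and only if
`|p(z)| ≥ |Im z| ^ d` for all `z`. Convergence of logarithmic derivatives shows that
`exp (a z - s² z²)` is a limit of products of factors `1 - r X`, and `f` is a limit of its partial
products.
-/

/-! ### Logarithmic derivatives of formal power series -/

/-- `H` is the logarithmic derivative `F' / F` of the formal power series `F`, written without
division. -/
def IsLogDeriv (F H : PowerSeries ℂ) : Prop :=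
  PowerSeries.derivative ℂ F = F * H

theorem IsLogDeriv.one : IsLogDeriv 1 0 := by
  simp [IsLogDeriv]

theorem IsLogDeriv.mul {F G H K : PowerSeries ℂ} (hF : IsLogDeriv F H) (hG : IsLogDeriv G K) :
    IsLogDeriv (F * G) (H + K) := by
  unfold IsLogDeriv at *
  rw [Derivation.leibniz, hF, hG, smul_eq_mul, smul_eq_mul]
  ring

theorem IsLogDeriv.prod {ι : Type*} (s : Finset ι) {F H : ι → PowerSeries ℂ}
    (h : ∀ i ∈ s, IsLogDeriv (F i) (H i)) : IsLogDeriv (∏ i ∈ s, F i) (∑ i ∈ s, H i) := by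
  classical
  induction s using Finset.induction_on with
  | empty => simpa using IsLogDeriv.one
  | insert a s ha ih =>
    rw [Finset.prod_insert ha, Finset.sum_insert ha]
    exact (h a (by simp)).mul (ih fun i hi => h i (by simp [hi]))

theorem IsLogDeriv.exists_of_constantCoeff {F : PowerSeries ℂ} (hF : PowerSeries.coeff 0 F = 1) :
    ∃ H, IsLogDeriv F H := by
  refine ⟨F⁻¹ * PowerSeries.derivative ℂ F, ?_⟩
  rw [IsLogDeriv, ← mul_assoc, PowerSeries.mul_inv_cancel, one_mul]
  rw [← PowerSeries.coeff_zero_eq_constantCoeff_apply, hF]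
  exact one_ne_zero

theorem IsLogDeriv.coeff_succ {F H : PowerSeries ℂ} (h : IsLogDeriv F H) (k : ℕ) :
    PowerSeries.coeff (k + 1) F * ((k : ℂ) + 1)
      = ∑ p ∈ Finset.HasAntidiagonal.antidiagonal k,
          PowerSeries.coeff p.1 F * PowerSeries.coeff p.2 H := by
  rw [← PowerSeries.coeff_mul, ← h, PowerSeries.coeff_derivative]

/-- Newton's identities: the logarithmic derivative depends continuously on the power series, for
coefficientwise convergence. -/
theorem IsLogDeriv.tendsto_logDeriv {α : Type*} {l : Filter α} {F H : α → PowerSeries ℂ}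
    {F₀ H₀ : PowerSeries ℂ} (h : ∀ n, IsLogDeriv (F n) (H n)) (h₀ : IsLogDeriv F₀ H₀)
    (hc : ∀ n, PowerSeries.coeff 0 (F n) = 1) (hc₀ : PowerSeries.coeff 0 F₀ = 1)
    (hF : ∀ k, Tendsto (fun n => PowerSeries.coeff k (F n)) l (𝓝 (PowerSeries.coeff k F₀)))
    (k : ℕ) : Tendsto (fun n => PowerSeries.coeff k (H n)) l (𝓝 (PowerSeries.coeff k H₀)) := by
  induction k using Nat.strong_induction_on with
  | _ k ih =>
    -- As `F` has constant coefficient `1`, the identity `F' = F * H` can be solved for the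
    -- coefficients of `H` recursively.
    have key : ∀ {F H : PowerSeries ℂ}, IsLogDeriv F H → PowerSeries.coeff 0 F = 1 →
        PowerSeries.coeff k H = PowerSeries.coeff (k + 1) F * ((k : ℂ) + 1)
          - ∑ p ∈ (Finset.HasAntidiagonal.antidiagonal k).erase (0, k),
              PowerSeries.coeff p.1 F * PowerSeries.coeff p.2 H := by
      intro F H h hc
      rw [h.coeff_succ k, ← Finset.add_sum_erase _ _ (a := (0, k)) (by simp), hc]
      ring
    rw [key h₀ hc₀]
    simp only [fun n => key (h n) (hc n)]
    refine ((hF (k + 1)).mul_const _).sub (tendsto_finsetSum _ fun p hp => ?_)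
    refine (hF p.1).mul (ih p.2 ?_)
    obtain ⟨i, j⟩ := p
    simp only [Finset.mem_erase, Finset.HasAntidiagonal.mem_antidiagonal, ne_eq,
      Prod.mk.injEq] at hp ⊢
    omega

/-- A power series with constant coefficient `1` depends continuously on its logarithmic
derivative, for coefficientwise convergence. -/
theorem IsLogDeriv.tendsto_of_logDeriv {α : Type*} {l : Filter α} {F H : α → PowerSeries ℂ}
    {F₀ H₀ : PowerSeries ℂ} (h : ∀ n, IsLogDeriv (F n) (H n)) (h₀ : IsLogDeriv F₀ H₀)
    (hc : ∀ n, PowerSeries.coeff 0 (F n) = 1) (hc₀ : PowerSeries.coeff 0 F₀ = 1)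
    (hH : ∀ k, Tendsto (fun n => PowerSeries.coeff k (H n)) l (𝓝 (PowerSeries.coeff k H₀)))
    (k : ℕ) : Tendsto (fun n => PowerSeries.coeff k (F n)) l (𝓝 (PowerSeries.coeff k F₀)) := by
  induction k using Nat.strong_induction_on with
  | _ k ih =>
    cases k with
    | zero => simp only [hc, hc₀]; exact tendsto_const_nhds
    | succ k =>
      have hk : (k : ℂ) + 1 ≠ 0 := Nat.cast_add_one_ne_zero k
      have key : ∀ {F H : PowerSeries ℂ}, IsLogDeriv F H → PowerSeries.coeff (k + 1) F
          = (∑ p ∈ Finset.HasAntidiagonal.antidiagonal k,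
              PowerSeries.coeff p.1 F * PowerSeries.coeff p.2 H)
            / ((k : ℂ) + 1) := by
        intro F H h
        rw [eq_div_iff hk, h.coeff_succ k]
      rw [key h₀]
      simp only [fun n => key (h n)]
      refine (tendsto_finsetSum _ fun p hp => ?_).div_const _
      refine (ih p.1 ?_).mul (hH p.2)
      have := Finset.HasAntidiagonal.mem_antidiagonal.1 hp
      omega

/-- The power series `∏ (1 - r X)`, over the elements `r` of a finite multiset. -/
noncomputable def rootSeries (S : Multiset ℂ) : PowerSeries ℂ :=
  (S.map fun r => 1 - PowerSeries.C r * PowerSeries.X).prod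

theorem rootSeries_cons (r : ℂ) (S : Multiset ℂ) :
    rootSeries (r ::ₘ S) = (1 - PowerSeries.C r * PowerSeries.X) * rootSeries S := by
  simp [rootSeries]

theorem coeff_zero_rootSeries (S : Multiset ℂ) : PowerSeries.coeff 0 (rootSeries S) = 1 := by
  induction S using Multiset.induction_on with
  | empty => simp [rootSeries]
  | cons r S ih =>
    rw [PowerSeries.coeff_zero_eq_constantCoeff_apply] at ih ⊢
    simp [rootSeries_cons, ih]

theorem isLogDeriv_one_sub (r : ℂ) :
    IsLogDeriv (1 - PowerSeries.C r * PowerSeries.X) (PowerSeries.mk fun k => -r ^ (k + 1)) := by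
  unfold IsLogDeriv
  have hd : PowerSeries.derivative ℂ (1 - PowerSeries.C r * PowerSeries.X : PowerSeries ℂ)
      = -PowerSeries.C r := by
    rw [map_sub, PowerSeries.derivative_one, Derivation.leibniz, PowerSeries.derivative_X,
      PowerSeries.derivative_C]
    simp
  rw [hd]
  ext k
  cases k with
  | zero => simp [sub_mul, mul_assoc]
  | succ k =>
    rw [sub_mul, one_mul, mul_assoc, map_sub, PowerSeries.coeff_C_mul,
      PowerSeries.coeff_succ_X_mul, PowerSeries.coeff_mk, PowerSeries.coeff_mk, map_neg,
      PowerSeries.coeff_C]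
    simp
    ring

/-- The coefficients of the logarithmic derivative of `∏ (1 - r X)` are the negatives of the power
sums of the numbers `r`. -/
theorem isLogDeriv_rootSeries (S : Multiset ℂ) :
    IsLogDeriv (rootSeries S) (PowerSeries.mk fun k => -(S.map fun r => r ^ (k + 1)).sum) := by
  induction S using Multiset.induction_on with
  | empty =>
    have : (PowerSeries.mk fun k => -((0 : Multiset ℂ).map fun r => r ^ (k + 1)).sum) = 0 := by
      ext; simp
    rw [this]
    simpa [rootSeries] using IsLogDeriv.one
  | cons r S ih =>
    rw [rootSeries_cons]
    convert (isLogDeriv_one_sub r).mul ih using 1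
    ext k
    simp
    ring

/-! ### Real-rooted polynomials and differential operators -/

/-- All complex roots of `p` are real. -/
def RealRooted (p : ℂ[X]) : Prop :=
  ∀ z : ℂ, p.eval z = 0 → z.im = 0

/-- The lower bound that a real-rooted monic polynomial satisfies off the real axis. It passes to
limits and excludes nonreal zeros, so real-rootedness is a closed condition. -/
theorem RealRooted.abs_im_pow_le {p : ℂ[X]} (h : RealRooted p) (hp : p.Monic) (z : ℂ) :
    |z.im| ^ p.natDegree ≤ ‖p.eval z‖ := by
  have hs : p.Splits := IsAlgClosed.splits p
  rw [hs.eval_eq_prod_roots, hp.leadingCoeff, one_mul, hs.natDegree_eq_card_roots]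
  have hr : ∀ r ∈ p.roots, |z.im| ≤ ‖z - r‖ := by
    intro r hr
    have h1 := Complex.abs_im_le_norm (z - r)
    rwa [Complex.sub_im, h r (isRoot_of_mem_roots hr), sub_zero] at h1
  generalize p.roots = S at hr
  induction S using Multiset.induction_on with
  | empty => simp
  | cons r S ih =>
    rw [Multiset.card_cons, pow_succ', Multiset.map_cons, Multiset.prod_cons, norm_mul]
    exact mul_le_mul (hr r (by simp)) (ih fun r' hr' => hr r' (by simp [hr']))
      (by positivity) (norm_nonneg _)

/-- For real `r`, the operator `1 - r D` preserves real-rootedness: at a nonreal zero of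
`p - r p'` the number `p' / p = ∑ 1 / (z - rᵢ)` would be real, but its imaginary part has the sign
opposite to that of `Im z`. -/
theorem RealRooted.sub_derivative {p : ℂ[X]} (h : RealRooted p) (r : ℝ) :
    RealRooted (p - C (r : ℂ) * derivative p) := by
  intro z hz
  by_contra him
  have hpz : p.eval z ≠ 0 := fun h0 => him (h z h0)
  rw [eval_sub, eval_mul, eval_C,
    (IsAlgClosed.splits p).eval_derivative_eq_eval_mul_sum hpz] at hz
  have h1 : (r : ℂ) * (p.roots.map fun w => 1 / (z - w)).sum = 1 := by
    have : p.eval z * (1 - (r : ℂ) * (p.roots.map fun w => 1 / (z - w)).sum) = 0 := by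
      rw [← hz]; ring
    rcases mul_eq_zero.1 this with h0 | h0
    · exact absurd h0 hpz
    · exact (sub_eq_zero.1 h0).symm
  have key : ∀ S : Multiset ℂ, (∀ w ∈ S, w.im = 0) →
      S = 0 ∨ z.im * ((S.map fun w => 1 / (z - w)).sum).im < 0 := by
    intro S
    induction S using Multiset.induction_on with
    | empty => simp
    | cons w S ih =>
      intro hS
      right
      have hw := hS w (by simp)
      rw [Multiset.map_cons, Multiset.sum_cons, Complex.add_im, mul_add]
      have hne : z - w ≠ 0 := by
        intro h0
        rw [sub_eq_zero.1 h0] at him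
        exact him hw
      have h2 : z.im * (1 / (z - w)).im < 0 := by
        rw [one_div, Complex.inv_im, Complex.sub_im, hw, sub_zero, mul_div_assoc', mul_neg]
        refine div_neg_of_neg_of_pos ?_ (Complex.normSq_pos.2 hne)
        have := mul_self_pos.2 him
        linarith
      rcases ih fun w' hw' => hS w' (by simp [hw']) with h0 | h0
      · simpa [h0] using h2
      · linarith
  rcases key p.roots fun w hw => h w (isRoot_of_mem_roots hw) with h0 | h0
  · rw [h0] at h1
    simp at h1
  · have h2 := congrArg Complex.im h1
    rw [Complex.im_ofReal_mul, Complex.one_im] at h2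
    rcases mul_eq_zero.1 h2 with h3 | h3
    · simp [h3] at h1
    · rw [h3, mul_zero] at h0
      exact lt_irrefl _ h0

/-- The operator `F(D)` on polynomials, for a formal power series `F`; the terms of order greater
than the degree of `p` vanish on `p` and are left out of the sum. -/
noncomputable def seriesDiff (F : PowerSeries ℂ) (p : ℂ[X]) : ℂ[X] :=
  ∑ k ∈ Finset.range (p.natDegree + 1), C (PowerSeries.coeff k F) * derivative^[k] p

theorem aeval_derivative_apply (q p : ℂ[X]) {N : ℕ} (hN : q.natDegree < N) :
    aeval (derivative : Module.End ℂ ℂ[X]) q p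
      = ∑ k ∈ Finset.range N, C (q.coeff k) * derivative^[k] p := by
  rw [aeval_eq_sum_range' hN, LinearMap.sum_apply]
  refine Finset.sum_congr rfl fun k _ => ?_
  rw [LinearMap.smul_apply, Module.End.pow_apply, smul_eq_C_mul]

theorem seriesDiff_eq_aeval (F : PowerSeries ℂ) {p : ℂ[X]} {N : ℕ} (hN : p.natDegree ≤ N) :
    seriesDiff F p
      = aeval (derivative : Module.End ℂ ℂ[X]) (PowerSeries.trunc (N + 1) F) p := by
  rw [aeval_derivative_apply _ _ (PowerSeries.natDegree_trunc_lt F N), seriesDiff]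
  refine Finset.sum_subset_zero_on_sdiff (Finset.range_subset_range.2 (by omega)) ?_ ?_
  · intro k hk
    simp only [Finset.mem_sdiff, Finset.mem_range] at hk
    rw [iterate_derivative_eq_zero (by omega), mul_zero]
  · intro k hk
    rw [PowerSeries.coeff_trunc, if_pos]
    have := Finset.mem_range.1 hk
    omega

theorem natDegree_seriesDiff_le (F : PowerSeries ℂ) (p : ℂ[X]) :
    (seriesDiff F p).natDegree ≤ p.natDegree := by
  refine natDegree_sum_le_of_forall_le _ _ fun k _ => ?_
  refine (natDegree_C_mul_le _ _).trans ((natDegree_iterate_derivative p k).trans (by omega))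

theorem seriesDiff_mul (F G : PowerSeries ℂ) (p : ℂ[X]) :
    seriesDiff (F * G) p = seriesDiff F (seriesDiff G p) := by
  -- `D ^ (deg p + 1)` annihilates `p`, so only the product modulo `X ^ (deg p + 1)` matters.
  have hdvd : (X : ℂ[X]) ^ (p.natDegree + 1) ∣
      PowerSeries.trunc (p.natDegree + 1) (F * G)
        - PowerSeries.trunc (p.natDegree + 1) F * PowerSeries.trunc (p.natDegree + 1) G := by
    rw [X_pow_dvd_iff]
    intro k hk
    rw [coeff_sub, PowerSeries.coeff_trunc, if_pos hk,
      PowerSeries.coeff_mul_eq_coeff_trunc_mul_trunc _ _ hk, ← Polynomial.coe_mul,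
      Polynomial.coeff_coe, sub_self]
  obtain ⟨q, hq⟩ := hdvd
  rw [sub_eq_iff_eq_add, mul_comm (X ^ _)] at hq
  rw [seriesDiff_eq_aeval F (natDegree_seriesDiff_le G p), seriesDiff_eq_aeval G le_rfl,
    seriesDiff_eq_aeval (F * G) le_rfl, hq, map_add, map_mul, map_mul, LinearMap.add_apply,
    Module.End.mul_apply, Module.End.mul_apply, map_pow, aeval_X,
    Module.End.pow_apply, iterate_derivative_eq_zero (Nat.lt_succ_self _), map_zero, zero_add]

theorem seriesDiff_natDegree_monic {F : PowerSeries ℂ} (hF : PowerSeries.coeff 0 F = 1)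
    {p : ℂ[X]} (hp : p.Monic) :
    (seriesDiff F p).Monic ∧ (seriesDiff F p).natDegree = p.natDegree := by
  have hdeg : (∑ k ∈ Finset.range p.natDegree,
      C (PowerSeries.coeff (k + 1) F) * derivative^[k + 1] p).degree < p.degree := by
    refine (degree_sum_le _ _).trans_lt ?_
    rw [Finset.sup_lt_iff (by rw [bot_lt_iff_ne_bot, ne_eq, degree_eq_bot]; exact hp.ne_zero)]
    rintro k -
    rw [Function.iterate_succ_apply]
    refine lt_of_le_of_lt ?_ (degree_derivative_lt hp.ne_zero)
    rw [← smul_eq_C_mul]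
    refine (degree_smul_le _ _).trans ?_
    induction k with
    | zero => exact le_rfl
    | succ k ih =>
      rw [Function.iterate_succ_apply']
      exact degree_derivative_le.trans ih
  have hs : seriesDiff F p = p + ∑ k ∈ Finset.range p.natDegree,
      C (PowerSeries.coeff (k + 1) F) * derivative^[k + 1] p := by
    rw [seriesDiff, Finset.sum_range_succ', hF]
    simp [add_comm]
  rw [hs]
  exact ⟨hp.add_of_left hdeg, natDegree_add_eq_left_of_degree_lt hdeg⟩

/-- The operator `F(D)` maps real-rooted monic polynomials to real-rooted polynomials. -/
def PreservesRealRoots (F : PowerSeries ℂ) : Prop :=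
  ∀ p : ℂ[X], p.Monic → RealRooted p → RealRooted (seriesDiff F p)

theorem PreservesRealRoots.one : PreservesRealRoots 1 := by
  intro p _ h
  have : seriesDiff 1 p = p := by
    rw [seriesDiff, Finset.sum_range_succ']
    simp [PowerSeries.coeff_one]
  rwa [this]

theorem PreservesRealRoots.mul {F G : PowerSeries ℂ} (hF : PreservesRealRoots F)
    (hG : PreservesRealRoots G) (hG0 : PowerSeries.coeff 0 G = 1) :
    PreservesRealRoots (F * G) := by
  intro p hp h
  rw [seriesDiff_mul]
  exact hF _ (seriesDiff_natDegree_monic hG0 hp).1 (hG p hp h)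

theorem preservesRealRoots_one_sub (r : ℝ) :
    PreservesRealRoots (1 - PowerSeries.C (r : ℂ) * PowerSeries.X) := by
  intro p _ h
  convert h.sub_derivative r using 1
  rw [seriesDiff_eq_aeval _ (Nat.le_succ p.natDegree),
    aeval_derivative_apply _ _ (PowerSeries.natDegree_trunc_lt _ _), Finset.sum_range_succ',
    Finset.sum_range_succ']
  have hcoeff : ∀ k, (PowerSeries.trunc (p.natDegree + 1 + 1)
      (1 - PowerSeries.C (r : ℂ) * PowerSeries.X : PowerSeries ℂ)).coeff k
      = if k < p.natDegree + 1 + 1 then (if k = 0 then 1 else 0) - (r : ℂ) * (if k = 1 then 1 else 0)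
        else 0 := by
    intro k
    rw [PowerSeries.coeff_trunc, map_sub, PowerSeries.coeff_C_mul, PowerSeries.coeff_one,
      PowerSeries.coeff_X]
  simp only [hcoeff]
  rw [Finset.sum_eq_zero]
  · simp
    ring
  · intro k _
    simp

theorem PreservesRealRoots.of_tendsto {α : Type*} {l : Filter α} [l.NeBot]
    {F : α → PowerSeries ℂ} {F₀ : PowerSeries ℂ} (h : ∀ n, PreservesRealRoots (F n))
    (hc : ∀ n, PowerSeries.coeff 0 (F n) = 1)
    (hF : ∀ k, Tendsto (fun n => PowerSeries.coeff k (F n)) l (𝓝 (PowerSeries.coeff k F₀))) :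
    PreservesRealRoots F₀ := by
  intro p hp hr z hz
  have hlim : Tendsto (fun n => ‖(seriesDiff (F n) p).eval z‖) l
      (𝓝 ‖(seriesDiff F₀ p).eval z‖) := by
    refine Tendsto.norm ?_
    simp only [seriesDiff, eval_finsetSum, eval_mul, eval_C]
    exact tendsto_finsetSum _ fun k _ => (hF k).mul_const _
  have hle : |z.im| ^ p.natDegree ≤ ‖(seriesDiff F₀ p).eval z‖ := by
    refine ge_of_tendsto' hlim fun n => ?_
    have hm := seriesDiff_natDegree_monic (hc n) hp
    rw [← hm.2]
    exact (h n p hp hr).abs_im_pow_le hm.1 z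
  rw [hz, norm_zero] at hle
  exact abs_eq_zero.1 (eq_zero_of_pow_eq_zero (le_antisymm hle (by positivity)))

theorem preservesRealRoots_rootSeries {S : Multiset ℂ} (hS : ∀ r ∈ S, r.im = 0) :
    PreservesRealRoots (rootSeries S) := by
  induction S using Multiset.induction_on with
  | empty => simpa [rootSeries] using PreservesRealRoots.one
  | cons r S ih =>
    rw [rootSeries_cons]
    refine PreservesRealRoots.mul ?_ (ih fun r' hr' => hS r' (by simp [hr']))
      (coeff_zero_rootSeries S)
    have hr : r = (r.re : ℂ) := Complex.ext rfl (by simp [hS r (by simp)])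
    rw [hr]
    exact preservesRealRoots_one_sub r.re

/-- The series of `exp (a z - s² z²)` preserves real-rootedness: it is the limit of the polynomials
`(1 + a z / n²)^(n²) ((1 - s z / n) (1 + s z / n))^(n²)`, whose logarithmic derivatives converge. -/
theorem preservesRealRoots_gaussian {F : PowerSeries ℂ} (a s : ℝ)
    (hc : PowerSeries.coeff 0 F = 1)
    (h : IsLogDeriv F (PowerSeries.C (a : ℂ) - PowerSeries.C (2 * (s : ℂ) ^ 2) * PowerSeries.X)) :
    PreservesRealRoots F := by
  -- Each factor is taken `(n + 1) ^ 2` times: a square, so that no square roots occur, and `n + 1`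
  -- rather than `n`, so that the denominators do not vanish.
  set S : ℕ → Multiset ℂ := fun n =>
    Multiset.replicate ((n + 1) ^ 2) (-(a : ℂ) / ((n : ℂ) + 1) ^ 2)
      + (Multiset.replicate ((n + 1) ^ 2) ((s : ℂ) / ((n : ℂ) + 1))
        + Multiset.replicate ((n + 1) ^ 2) (-(s : ℂ) / ((n : ℂ) + 1))) with hSdef
  have hreal : ∀ n, ∀ r ∈ S n, r.im = 0 := by
    intro n r hr
    have hr' : r = ((-a / ((n : ℝ) + 1) ^ 2 : ℝ) : ℂ) ∨ r = ((s / ((n : ℝ) + 1) : ℝ) : ℂ)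
        ∨ r = ((-s / ((n : ℝ) + 1) : ℝ) : ℂ) := by
      simp only [hSdef, Multiset.mem_add, Multiset.mem_replicate] at hr
      push_cast
      tauto
    rcases hr' with h | h | h <;> rw [h] <;> exact Complex.ofReal_im _
  have hinv : Tendsto (fun n : ℕ => ((n : ℂ) + 1)⁻¹) atTop (𝓝 0) := by
    have := tendsto_one_div_add_atTop_nhds_zero_nat (𝕜 := ℂ)
    simpa using this
  refine PreservesRealRoots.of_tendsto (l := atTop) (F := fun n => rootSeries (S n))
    (fun n => preservesRealRoots_rootSeries (hreal n)) (fun n => coeff_zero_rootSeries _)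
    (IsLogDeriv.tendsto_of_logDeriv (fun n => isLogDeriv_rootSeries (S n)) h
      (fun n => coeff_zero_rootSeries _) hc fun k => ?_)
  have hS : ∀ n : ℕ, PowerSeries.coeff k
      (PowerSeries.mk fun k => -((S n).map fun r => r ^ (k + 1)).sum)
      = -((-(a : ℂ)) ^ (k + 1) * (((n : ℂ) + 1)⁻¹ ^ 2) ^ k
        + ((s : ℂ) ^ (k + 1) + (-(s : ℂ)) ^ (k + 1))
          * (((n : ℂ) + 1) * ((n : ℂ) + 1)⁻¹ ^ k)) := by
    intro n
    have hn : (n : ℂ) + 1 ≠ 0 := Nat.cast_add_one_ne_zero n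
    simp only [hSdef, div_eq_mul_inv, ← inv_pow, PowerSeries.coeff_mk, Multiset.map_add,
      Multiset.map_replicate,
      Multiset.sum_add, Multiset.sum_replicate, nsmul_eq_mul]
    push_cast
    have hu : ((n : ℂ) + 1) * ((n : ℂ) + 1)⁻¹ = 1 := mul_inv_cancel₀ hn
    generalize ((n : ℂ) + 1)⁻¹ = u at hu
    generalize (n : ℂ) + 1 = M at hu
    linear_combination (-(-(a : ℂ)) ^ (k + 1) * (u ^ 2) ^ k * (M * u + 1)
      - ((s : ℂ) ^ (k + 1) + (-(s : ℂ)) ^ (k + 1)) * u ^ k * M) * hu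
  simp only [hS]
  rcases k with _ | _ | k
  · simp
  · have hS1 : ∀ n : ℕ, ((n : ℂ) + 1) * ((n : ℂ) + 1)⁻¹ ^ (0 + 1) = 1 := fun n => by
      rw [zero_add, pow_one, mul_inv_cancel₀ (Nat.cast_add_one_ne_zero n)]
    simp only [hS1]
    have := (((hinv.pow 2).pow 1).const_mul ((-(a : ℂ)) ^ (0 + 1 + 1))).add_const
      (((s : ℂ) ^ (0 + 1 + 1) + (-(s : ℂ)) ^ (0 + 1 + 1)) * 1)
    convert this.neg using 2
    simp only [map_sub, PowerSeries.coeff_C_mul, PowerSeries.coeff_X, PowerSeries.coeff_C]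
    simp
    ring
  · have hS2 : ∀ n : ℕ, ((n : ℂ) + 1) * ((n : ℂ) + 1)⁻¹ ^ (k + 1 + 1) = ((n : ℂ) + 1)⁻¹ ^ (k + 1) :=
      fun n => by
        rw [pow_succ' _ (k + 1), ← mul_assoc, mul_inv_cancel₀ (Nat.cast_add_one_ne_zero n), one_mul]
    simp only [hS2]
    have := (((hinv.pow 2).pow (k + 1 + 1)).const_mul ((-(a : ℂ)) ^ (k + 1 + 1 + 1))).add
      ((hinv.pow (k + 1)).const_mul ((s : ℂ) ^ (k + 1 + 1 + 1) + (-(s : ℂ)) ^ (k + 1 + 1 + 1)))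
    convert this.neg using 2
    simp only [map_sub, PowerSeries.coeff_C_mul, PowerSeries.coeff_X, PowerSeries.coeff_C]
    simp

/-! ### Taylor series of entire functions -/

/-- The Taylor series of `g` at `0`, as a formal power series. -/
noncomputable def taylorSeries (g : ℂ → ℂ) : PowerSeries ℂ :=
  PowerSeries.mk fun k => iteratedDeriv k g 0 / (k ! : ℂ)

theorem coeff_taylorSeries (g : ℂ → ℂ) (k : ℕ) :
    PowerSeries.coeff k (taylorSeries g) = iteratedDeriv k g 0 / (k ! : ℂ) :=
  PowerSeries.coeff_mk _ _

theorem coeff_zero_taylorSeries (g : ℂ → ℂ) : PowerSeries.coeff 0 (taylorSeries g) = g 0 := by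
  simp [coeff_taylorSeries]

theorem derivative_taylorSeries (g : ℂ → ℂ) :
    PowerSeries.derivative ℂ (taylorSeries g) = taylorSeries (deriv g) := by
  ext k
  rw [PowerSeries.coeff_derivative, coeff_taylorSeries, coeff_taylorSeries, iteratedDeriv_succ',
    Nat.factorial_succ]
  have h1 : (k ! : ℂ) ≠ 0 := Nat.cast_ne_zero.2 k.factorial_ne_zero
  have h2 : (k : ℂ) + 1 ≠ 0 := Nat.cast_add_one_ne_zero k
  push_cast
  field_simp

theorem taylorSeries_mul {g h : ℂ → ℂ} (hg : Differentiable ℂ g) (hh : Differentiable ℂ h) :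
    taylorSeries (g * h) = taylorSeries g * taylorSeries h := by
  ext k
  rw [PowerSeries.coeff_mul, coeff_taylorSeries, iteratedDeriv_mul hg.contDiff.contDiffAt
    hh.contDiff.contDiffAt, Finset.Nat.sum_antidiagonal_eq_sum_range_succ_mk, Finset.sum_div]
  refine Finset.sum_congr rfl fun i hi => ?_
  have hi' : i ≤ k := Nat.lt_succ_iff.1 (Finset.mem_range.1 hi)
  have hk : (k ! : ℂ) ≠ 0 := Nat.cast_ne_zero.2 k.factorial_ne_zero
  have h1 : (i ! : ℂ) ≠ 0 := Nat.cast_ne_zero.2 i.factorial_ne_zero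
  have h2 : ((k - i)! : ℂ) ≠ 0 := Nat.cast_ne_zero.2 (k - i).factorial_ne_zero
  rw [coeff_taylorSeries, coeff_taylorSeries, Nat.cast_choose ℂ hi']
  field_simp

theorem taylorSeries_one : taylorSeries 1 = 1 := by
  ext k
  rw [coeff_taylorSeries, PowerSeries.coeff_one]
  cases k with
  | zero => simp
  | succ k =>
    have : deriv (1 : ℂ → ℂ) = 0 := by ext; simp
    rw [iteratedDeriv_succ', this]
    simp

theorem taylorSeries_prod {ι : Type*} (s : Finset ι) {g : ι → ℂ → ℂ}
    (hg : ∀ i, Differentiable ℂ (g i)) :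
    taylorSeries (∏ i ∈ s, g i) = ∏ i ∈ s, taylorSeries (g i) := by
  classical
  induction s using Finset.induction_on with
  | empty => simpa using taylorSeries_one
  | insert a s ha ih =>
    rw [Finset.prod_insert ha, Finset.prod_insert ha, taylorSeries_mul (hg a), ih]
    exact Differentiable.finsetProd fun i _ => hg i

theorem taylorSeries_affine (a b : ℂ) :
    taylorSeries (fun z => a + b * z) = PowerSeries.C a + PowerSeries.C b * PowerSeries.X := by
  ext k
  rw [coeff_taylorSeries, map_add, PowerSeries.coeff_C_mul, PowerSeries.coeff_C,
    PowerSeries.coeff_X]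
  have hd : deriv (fun z : ℂ => a + b * z) = fun _ => b := by
    ext z
    simp
  rcases k with _ | _ | k
  · simp
  · simp [hd]
  · rw [iteratedDeriv_succ', hd, iteratedDeriv_const]
    simp

/-- Locally uniform convergence of entire functions implies coefficientwise convergence of their
Taylor series. -/
theorem tendsto_coeff_taylorSeries {α : Type*} {l : Filter α} {F : α → ℂ → ℂ} {f : ℂ → ℂ}
    (h : TendstoLocallyUniformlyOn F f l Set.univ) (hF : ∀ n, Differentiable ℂ (F n)) (k : ℕ) :
    Tendsto (fun n => PowerSeries.coeff k (taylorSeries (F n))) l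
      (𝓝 (PowerSeries.coeff k (taylorSeries f))) := by
  simp only [coeff_taylorSeries]
  refine Tendsto.div_const ?_ _
  induction k generalizing F f with
  | zero => simpa using h.tendsto_at (Set.mem_univ 0)
  | succ k ih =>
    simp only [iteratedDeriv_succ']
    exact ih (h.deriv (Eventually.of_forall fun n => (hF n).differentiableOn) isOpen_univ)
      fun n => (hF n).deriv

/-! ### The factors of the Laguerre–Pólya representation -/

/-- The factor `exp (c z - σ² z² / 2)` of a function in the Laguerre–Pólya class. -/
noncomputable def gaussianFactor (c σ : ℝ) (z : ℂ) : ℂ :=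
  Complex.exp ((c : ℂ) * z - (σ : ℂ) ^ 2 / 2 * z ^ 2)

theorem differentiable_gaussianFactor (c σ : ℝ) : Differentiable ℂ (gaussianFactor c σ) := by
  unfold gaussianFactor
  fun_prop

theorem isLogDeriv_gaussianFactor (c σ : ℝ) :
    IsLogDeriv (taylorSeries (gaussianFactor c σ))
      (PowerSeries.C (c : ℂ) - PowerSeries.C ((σ : ℂ) ^ 2) * PowerSeries.X) := by
  have hd : deriv (gaussianFactor c σ)
      = gaussianFactor c σ * fun z => (c : ℂ) + (-(σ : ℂ) ^ 2) * z := by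
    ext z
    have h1 : HasDerivAt (fun z : ℂ => (c : ℂ) * z - (σ : ℂ) ^ 2 / 2 * z ^ 2)
        ((c : ℂ) * 1 - (σ : ℂ) ^ 2 / 2 * ((2 : ℕ) * z ^ (2 - 1))) z :=
      ((hasDerivAt_id z).const_mul _).sub ((hasDerivAt_pow 2 z).const_mul _)
    refine h1.cexp.deriv.trans ?_
    rw [Pi.mul_apply, gaussianFactor]
    push_cast
    ring
  rw [IsLogDeriv, derivative_taylorSeries, hd, taylorSeries_mul
    (differentiable_gaussianFactor c σ) (by fun_prop), taylorSeries_affine, map_neg]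
  ring

theorem preservesRealRoots_gaussianFactor (c σ : ℝ) :
    PreservesRealRoots (taylorSeries (gaussianFactor c σ)) := by
  refine preservesRealRoots_gaussian c (σ / √2)
    (by rw [coeff_zero_taylorSeries]; simp [gaussianFactor]) ?_
  convert isLogDeriv_gaussianFactor c σ using 4
  have h : 2 * (σ / √2) ^ 2 = σ ^ 2 := by
    rw [div_pow, Real.sq_sqrt zero_le_two]
    ring
  exact_mod_cast congrArg (fun t : ℝ => (t : ℂ)) h

/-- The genus-one factor `(1 - z / x) e^{z / x}`. -/
noncomputable def weierstrassFactor (x : ℝ) (z : ℂ) : ℂ :=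
  (1 - z / (x : ℂ)) * Complex.exp (z / (x : ℂ))

theorem differentiable_weierstrassFactor (x : ℝ) : Differentiable ℂ (weierstrassFactor x) := by
  unfold weierstrassFactor
  fun_prop

theorem taylorSeries_weierstrassFactor (x : ℝ) :
    taylorSeries (weierstrassFactor x) =
      (1 - PowerSeries.C ((x⁻¹ : ℝ) : ℂ) * PowerSeries.X)
        * taylorSeries (gaussianFactor x⁻¹ 0) := by
  have h : weierstrassFactor x
      = (fun z => (1 : ℂ) + (-((x⁻¹ : ℝ) : ℂ)) * z) * gaussianFactor x⁻¹ 0 := by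
    ext z
    rw [weierstrassFactor, Pi.mul_apply, gaussianFactor]
    push_cast
    congr 2 <;> ring
  rw [h, taylorSeries_mul (by fun_prop) (differentiable_gaussianFactor _ _), taylorSeries_affine]
  simp only [map_one, map_neg]
  ring

theorem isLogDeriv_weierstrassFactor (x : ℝ) :
    IsLogDeriv (taylorSeries (weierstrassFactor x))
      (PowerSeries.mk fun k => if k = 0 then 0 else -((x⁻¹ : ℝ) : ℂ) ^ (k + 1)) := by
  rw [taylorSeries_weierstrassFactor]
  convert (isLogDeriv_one_sub ((x⁻¹ : ℝ) : ℂ)).mul (isLogDeriv_gaussianFactor x⁻¹ 0) using 1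
  ext k
  cases k <;> simp

theorem preservesRealRoots_weierstrassFactor (x : ℝ) :
    PreservesRealRoots (taylorSeries (weierstrassFactor x)) := by
  rw [taylorSeries_weierstrassFactor]
  exact (preservesRealRoots_one_sub _).mul (preservesRealRoots_gaussianFactor _ _)
    (by rw [coeff_zero_taylorSeries]; simp [gaussianFactor])

theorem norm_weierstrassFactor_sub_one_le {x : ℝ} {z : ℂ} (h : ‖z / (x : ℂ)‖ ≤ 1) :
    ‖weierstrassFactor x z - 1‖ ≤ 3 * ‖z / (x : ℂ)‖ ^ 2 := by
  unfold weierstrassFactor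
  set w : ℂ := z / (x : ℂ)
  have e : (1 - w) * Complex.exp w - 1
      = (1 - w) * (Complex.exp w - 1 - w) - w ^ 2 := by ring
  have h3 : ‖1 - w‖ ≤ 2 := by
    have := norm_sub_le (1 : ℂ) w
    rw [norm_one] at this
    linarith
  rw [e]
  calc ‖(1 - w) * (Complex.exp w - 1 - w) - w ^ 2‖
      ≤ ‖1 - w‖ * ‖Complex.exp w - 1 - w‖ + ‖w‖ ^ 2 := by
        have := norm_sub_le ((1 - w) * (Complex.exp w - 1 - w)) (w ^ 2)
        rwa [norm_mul, norm_pow] at this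
    _ ≤ 2 * ‖w‖ ^ 2 + ‖w‖ ^ 2 := by
        gcongr
        exact Complex.norm_exp_sub_one_sub_id_le h
    _ = 3 * ‖w‖ ^ 2 := by ring

theorem hasProdLocallyUniformlyOn_weierstrassFactor {ι : Type*} {x : ι → ℝ}
    (hx : Summable fun i => ((x i) ^ 2)⁻¹) :
    HasProdLocallyUniformlyOn (fun i => weierstrassFactor (x i))
      (fun z => ∏' i, weierstrassFactor (x i) z) Set.univ := by
  refine hasProdLocallyUniformlyOn_of_forall_compact isOpen_univ fun K _ hK => ?_
  obtain ⟨R, hR⟩ := hK.isBounded.exists_norm_le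
  have hsq : Summable fun i => R ^ 2 * ((x i) ^ 2)⁻¹ := hx.mul_left _
  have hle : ∀ i, ∀ z ∈ K, ‖z / (x i : ℂ)‖ ^ 2 ≤ R ^ 2 * ((x i) ^ 2)⁻¹ := by
    intro i z hz
    rw [norm_div, div_pow, Complex.norm_real, Real.norm_eq_abs, sq_abs, div_eq_mul_inv]
    gcongr
    exact hR z hz
  have := Summable.hasProdUniformlyOn_one_add (f := fun i z => weierstrassFactor (x i) z - 1) hK
    (hsq.mul_left 3) ?_
    (fun i => ((differentiable_weierstrassFactor (x i)).continuous.sub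
      continuous_const).continuousOn)
  · simpa using this
  · have h1 : ∀ᶠ i in cofinite, R ^ 2 * ((x i) ^ 2)⁻¹ < 1 :=
      hsq.tendsto_cofinite_zero.eventually (gt_mem_nhds one_pos)
    filter_upwards [h1] with i hi z hz
    have hw : ‖z / (x i : ℂ)‖ ≤ 1 := by
      have := hle i z hz
      nlinarith [norm_nonneg (z / (x i : ℂ))]
    exact (norm_weierstrassFactor_sub_one_le hw).trans (by gcongr; exact hle i z hz)

/-! ### Functions in the Laguerre–Pólya class -/

section LaguerrePolya

variable {ι : Type*} {f : ℂ → ℂ} {C c σ : ℝ} {m : ℕ} {x : ι → ℝ}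

theorem LaguerrePolyaRep.eq_gaussianFactor_mul (hf : LaguerrePolyaRep f C c σ m x)
    (hf0 : f 0 = 1) : f = fun z => gaussianFactor c σ z * ∏' i, weierstrassFactor (x i) z := by
  have h0 := hf.eq_prod 0
  have hCm : (C : ℂ) * 0 ^ m = 1 := by
    rw [hf0] at h0
    simpa using h0.symm
  have hm : m = 0 := by
    by_contra hm
    simp [hm] at hCm
  subst hm
  ext z
  rw [hf.eq_prod z, show (C : ℂ) = 1 by simpa using hCm]
  simp [gaussianFactor, weierstrassFactor]

/-- The partial product of the Laguerre–Pólya representation over a finite set of zeros. -/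
noncomputable def partialProd (c σ : ℝ) (x : ι → ℝ) (s : Finset ι) : ℂ → ℂ :=
  gaussianFactor c σ * ∏ i ∈ s, weierstrassFactor (x i)

theorem differentiable_partialProd (c σ : ℝ) (x : ι → ℝ) (s : Finset ι) :
    Differentiable ℂ (partialProd c σ x s) :=
  (differentiable_gaussianFactor c σ).mul
    (Differentiable.finsetProd fun i _ => differentiable_weierstrassFactor (x i))

theorem taylorSeries_partialProd (c σ : ℝ) (x : ι → ℝ) (s : Finset ι) :
    taylorSeries (partialProd c σ x s)
      = taylorSeries (gaussianFactor c σ) * ∏ i ∈ s, taylorSeries (weierstrassFactor (x i)) := by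
  rw [partialProd, taylorSeries_mul (differentiable_gaussianFactor c σ)
    (Differentiable.finsetProd fun i _ => differentiable_weierstrassFactor (x i)),
    taylorSeries_prod s fun i => differentiable_weierstrassFactor (x i)]

theorem coeff_zero_taylorSeries_partialProd (c σ : ℝ) (x : ι → ℝ) (s : Finset ι) :
    PowerSeries.coeff 0 (taylorSeries (partialProd c σ x s)) = 1 := by
  rw [coeff_zero_taylorSeries]
  simp [partialProd, gaussianFactor, weierstrassFactor]

theorem preservesRealRoots_partialProd (c σ : ℝ) (x : ι → ℝ) (s : Finset ι) :
    PreservesRealRoots (taylorSeries (partialProd c σ x s)) := by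
  classical
  rw [taylorSeries_partialProd]
  have key : PreservesRealRoots (∏ i ∈ s, taylorSeries (weierstrassFactor (x i))) ∧
      PowerSeries.coeff 0 (∏ i ∈ s, taylorSeries (weierstrassFactor (x i))) = 1 := by
    induction s using Finset.induction_on with
    | empty => exact ⟨by simpa using PreservesRealRoots.one, by simp⟩
    | insert a s ha ih =>
      rw [Finset.prod_insert ha]
      refine ⟨(preservesRealRoots_weierstrassFactor (x a)).mul ih.1 ih.2, ?_⟩
      have h1 : PowerSeries.coeff 0 (taylorSeries (weierstrassFactor (x a))) = 1 := by
        rw [coeff_zero_taylorSeries]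
        simp [weierstrassFactor]
      have h2 := ih.2
      rw [PowerSeries.coeff_zero_eq_constantCoeff_apply] at h1 h2 ⊢
      rw [map_mul, h1, h2, one_mul]
  exact (preservesRealRoots_gaussianFactor c σ).mul key.1 key.2

theorem LaguerrePolyaRep.tendsto_coeff_partialProd (hf : LaguerrePolyaRep f C c σ m x)
    (hf0 : f 0 = 1) (k : ℕ) :
    Tendsto (fun s => PowerSeries.coeff k (taylorSeries (partialProd c σ x s))) atTop
      (𝓝 (PowerSeries.coeff k (taylorSeries f))) := by
  refine tendsto_coeff_taylorSeries ?_ (differentiable_partialProd c σ x) k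
  have hprod := hasProdLocallyUniformlyOn_weierstrassFactor hf.summable
  have hdiff : DifferentiableOn ℂ (fun z => ∏' i, weierstrassFactor (x i) z) Set.univ :=
    TendstoLocallyUniformlyOn.differentiableOn hprod (Eventually.of_forall fun s =>
      (Differentiable.fun_finsetProd fun i _ =>
        differentiable_weierstrassFactor (x i)).differentiableOn) isOpen_univ
  have hconst : TendstoLocallyUniformlyOn (fun _ : Finset ι => gaussianFactor c σ)
      (gaussianFactor c σ) atTop Set.univ := by
    intro u hu z _
    exact ⟨Set.univ, univ_mem, Eventually.of_forall fun _ _ _ => refl_mem_uniformity hu⟩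
  have := hconst.mul₀ hprod (differentiable_gaussianFactor c σ).continuous.continuousOn
    hdiff.continuousOn
  rw [hf.eq_gaussianFactor_mul hf0]
  refine this.congr fun s z _ => ?_
  simp [partialProd]

theorem LaguerrePolyaRep.preservesRealRoots (hf : LaguerrePolyaRep f C c σ m x)
    (hf0 : f 0 = 1) : PreservesRealRoots (taylorSeries f) :=
  PreservesRealRoots.of_tendsto (fun s => preservesRealRoots_partialProd c σ x s)
    (fun s => coeff_zero_taylorSeries_partialProd c σ x s) (hf.tendsto_coeff_partialProd hf0)

theorem summable_inv_pow_add_two {x : ι → ℝ} (hx : Summable fun i => ((x i) ^ 2)⁻¹) (k : ℕ) :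
    Summable fun i => (x i)⁻¹ ^ (k + 2) := by
  refine Summable.of_norm_bounded_eventually hx ?_
  filter_upwards [hx.tendsto_cofinite_zero.eventually (gt_mem_nhds one_pos)] with i hi
  have h1 : |(x i)⁻¹| ≤ 1 := by
    rw [← inv_pow, ← sq_abs] at hi
    nlinarith [abs_nonneg (x i)⁻¹]
  rw [pow_add, norm_mul, Real.norm_eq_abs, Real.norm_eq_abs, abs_pow, abs_pow, sq_abs, inv_pow,
    ← one_mul (x i ^ 2)⁻¹, ← mul_assoc, mul_one]
  gcongr
  exact pow_le_one₀ (abs_nonneg _) h1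

/-- The coefficients of the logarithmic derivative of `f` are the negatives of the moments of the
limit measure `σ² δ₀ + ∑ xᵢ⁻² δ_{1 / xᵢ}`. -/
theorem LaguerrePolyaRep.exists_isLogDeriv (hf : LaguerrePolyaRep f C c σ m x)
    (hf0 : f 0 = 1) :
    ∃ H, IsLogDeriv (taylorSeries f) H ∧ ∀ k, PowerSeries.coeff (k + 1) H
      = -((σ ^ 2 * 0 ^ k + ∑' i, (x i)⁻¹ ^ (k + 2) : ℝ) : ℂ) := by
  have hc : PowerSeries.coeff 0 (taylorSeries f) = 1 := by rw [coeff_zero_taylorSeries, hf0]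
  obtain ⟨H, hH⟩ := IsLogDeriv.exists_of_constantCoeff hc
  refine ⟨H, hH, fun k => ?_⟩
  have hlim := IsLogDeriv.tendsto_logDeriv
    (fun s => by
      rw [taylorSeries_partialProd]
      exact (isLogDeriv_gaussianFactor c σ).mul
        (IsLogDeriv.prod s fun i _ => isLogDeriv_weierstrassFactor (x i)))
    hH (fun s => coeff_zero_taylorSeries_partialProd c σ x s) hc
    (hf.tendsto_coeff_partialProd hf0) (k + 1)
  refine tendsto_nhds_unique hlim ?_
  -- The convergence factors `exp (z / xᵢ)` and the constant `c` only enter the coefficient of index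
  -- `0`, and the Gaussian factor only that of index `1`.
  have hsum : Tendsto (fun s : Finset ι => -((σ ^ 2 * 0 ^ k + ∑ i ∈ s, (x i)⁻¹ ^ (k + 2) : ℝ) : ℂ))
      atTop (𝓝 (-((σ ^ 2 * 0 ^ k + ∑' i, (x i)⁻¹ ^ (k + 2) : ℝ) : ℂ))) :=
    ((Complex.continuous_ofReal.tendsto _).comp
      ((summable_inv_pow_add_two hf.summable k).hasSum.const_add _)).neg
  refine hsum.congr fun s => ?_
  rw [map_add, map_sub, PowerSeries.coeff_C_mul, map_sum]
  simp only [PowerSeries.coeff_mk, PowerSeries.coeff_X, PowerSeries.coeff_C]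
  cases k with
  | zero =>
    simp
    ring
  | succ k => simp

end LaguerrePolya

/-! ### Appell polynomials -/

theorem applyDiff_eq_seriesDiff (f : ℂ → ℂ) (p : ℂ[X]) :
    applyDiff f p = seriesDiff (taylorSeries f) p := by
  simp only [applyDiff, seriesDiff, coeff_taylorSeries]

theorem monic_appellPoly {f : ℂ → ℂ} (hf0 : f 0 = 1) (d : ℕ) :
    (appellPoly f d).Monic ∧ (appellPoly f d).natDegree = d := by
  rw [appellPoly, applyDiff_eq_seriesDiff]
  have := seriesDiff_natDegree_monic (F := taylorSeries f)
    (by rw [coeff_zero_taylorSeries, hf0]) (monic_X_pow (R := ℂ) d)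
  rwa [natDegree_X_pow] at this

theorem coeff_appellPoly (f : ℂ → ℂ) {d k : ℕ} (hk : k ≤ d) :
    (appellPoly f d).coeff (d - k)
      = PowerSeries.coeff k (taylorSeries f) * (d.descFactorial k : ℂ) := by
  rw [appellPoly, applyDiff_eq_seriesDiff, seriesDiff, natDegree_X_pow, finsetSum_coeff,
    Finset.sum_eq_single k]
  · rw [coeff_C_mul, iterate_derivative_X_pow_eq_smul, coeff_smul, coeff_X_pow_self]
    simp
  · intro j hj hjk
    have := Finset.mem_range.1 hj
    rw [coeff_C_mul, iterate_derivative_X_pow_eq_smul, coeff_smul, coeff_X_pow,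
      if_neg (by omega), smul_zero, mul_zero]
  · intro h
    exact absurd (Finset.mem_range.2 (by omega)) h

theorem coeff_dilatePoly (α : ℂ) (p : ℂ[X]) (j : ℕ) :
    (dilatePoly α p).coeff j = α ^ p.natDegree * (p.coeff j * α⁻¹ ^ j) := by
  rw [dilatePoly, coeff_C_mul, comp_C_mul_X_coeff]

theorem scaledAppellPoly_zero {f : ℂ → ℂ} (hf0 : f 0 = 1) : scaledAppellPoly f 0 = 1 := by
  obtain ⟨h1, h2⟩ := monic_appellPoly hf0 0
  rw [scaledAppellPoly, dilatePoly, h2, h1.natDegree_eq_zero.1 h2]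
  simp

theorem coeff_scaledAppellPoly {f : ℂ → ℂ} (hf0 : f 0 = 1) {d k : ℕ} (hd : d ≠ 0) (hk : k ≤ d) :
    (scaledAppellPoly f d).coeff (d - k)
      = PowerSeries.coeff k (taylorSeries f) * ((d.descFactorial k : ℂ) / (d : ℂ) ^ k) := by
  have hd' : (d : ℂ) ≠ 0 := Nat.cast_ne_zero.2 hd
  rw [scaledAppellPoly, coeff_dilatePoly, coeff_appellPoly f hk, (monic_appellPoly hf0 d).2]
  obtain ⟨e, rfl⟩ := Nat.exists_eq_add_of_le hk
  rw [Nat.add_sub_cancel_left, one_div, inv_inv, pow_add, inv_pow, inv_pow]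
  field_simp

theorem monic_scaledAppellPoly {f : ℂ → ℂ} (hf0 : f 0 = 1) (d : ℕ) :
    (scaledAppellPoly f d).Monic ∧ (scaledAppellPoly f d).natDegree = d := by
  rcases eq_or_ne d 0 with rfl | hd
  · rw [scaledAppellPoly_zero hf0]
    exact ⟨monic_one, natDegree_one⟩
  have hle : (scaledAppellPoly f d).natDegree ≤ d := by
    rw [natDegree_le_iff_coeff_eq_zero]
    intro j hj
    rw [scaledAppellPoly, coeff_dilatePoly, coeff_eq_zero_of_natDegree_lt, zero_mul, mul_zero]
    rwa [(monic_appellPoly hf0 d).2]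
  have hcoeff : (scaledAppellPoly f d).coeff d = 1 := by
    have := coeff_scaledAppellPoly hf0 hd (Nat.zero_le d)
    rw [Nat.sub_zero, coeff_zero_taylorSeries, hf0] at this
    simpa using this
  exact ⟨monic_of_natDegree_le_of_coeff_eq_one d hle hcoeff,
    natDegree_eq_of_le_of_coeff_ne_zero hle (by rw [hcoeff]; exact one_ne_zero)⟩

theorem realRooted_scaledAppellPoly {f : ℂ → ℂ} (hf0 : f 0 = 1)
    (hf : PreservesRealRoots (taylorSeries f)) (d : ℕ) : RealRooted (scaledAppellPoly f d) := by
  rcases eq_or_ne d 0 with rfl | hd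
  · intro z hz
    rw [scaledAppellPoly_zero hf0, eval_one] at hz
    exact absurd hz one_ne_zero
  have hX : RealRooted (X ^ d : ℂ[X]) := by
    intro z hz
    rw [eval_pow, eval_X] at hz
    rw [eq_zero_of_pow_eq_zero hz, Complex.zero_im]
  have hA : RealRooted (appellPoly f d) := by
    rw [appellPoly, applyDiff_eq_seriesDiff]
    exact hf _ (monic_X_pow d) hX
  intro z hz
  have hd' : (d : ℂ) ≠ 0 := Nat.cast_ne_zero.2 hd
  rw [scaledAppellPoly, dilatePoly, eval_mul, eval_C, eval_comp, eval_mul, eval_C, eval_X,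
    one_div, inv_inv] at hz
  have h1 := hA _ ((mul_eq_zero.1 hz).resolve_left (pow_ne_zero _ (inv_ne_zero hd')))
  rw [← Complex.ofReal_natCast, Complex.im_ofReal_mul] at h1
  exact (mul_eq_zero.1 h1).resolve_left (Nat.cast_ne_zero.2 hd)

/-- The reciprocal polynomial of `∏ (X - r)` is `∏ (1 - r X)`. -/
theorem rootSeries_roots {p : ℂ[X]} (hp : p.Monic) :
    rootSeries p.roots = (p.reverse : PowerSeries ℂ) := by
  have hprod : p = (p.roots.map fun r => X - C r).prod := by
    have := (IsAlgClosed.splits p).eq_prod_roots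
    rwa [hp.leadingCoeff, C_1, one_mul] at this
  conv_rhs => rw [hprod]
  generalize p.roots = S
  induction S using Multiset.induction_on with
  | empty =>
    simp only [rootSeries, Multiset.map_zero, Multiset.prod_zero]
    rw [← C_1, reverse_C]
    simp
  | cons r S ih =>
    rw [rootSeries_cons, Multiset.map_cons, Multiset.prod_cons, reverse_mul_of_domain,
      Polynomial.coe_mul, ← ih]
    congr 1
    have : (X - C r : ℂ[X]).reverse = 1 - C r * X := by
      rw [reverse, natDegree_X_sub_C, reflect_sub, reflect_one_X, reflect_C, pow_one]
    rw [this]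
    simp

theorem coeff_rootSeries_roots {p : ℂ[X]} (hp : p.Monic) {k : ℕ} (hk : k ≤ p.natDegree) :
    PowerSeries.coeff k (rootSeries p.roots) = p.coeff (p.natDegree - k) := by
  rw [rootSeries_roots hp, Polynomial.coeff_coe, coeff_reverse, revAt_le hk]

theorem tendsto_descFactorial_div_pow (k : ℕ) :
    Tendsto (fun d : ℕ => (d.descFactorial k : ℂ) / (d : ℂ) ^ k) atTop (𝓝 1) := by
  have h : Tendsto (fun d : ℕ => (d.descFactorial k : ℝ) / (d : ℝ) ^ k) atTop (𝓝 1) := by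
    refine (Asymptotics.isEquivalent_iff_tendsto_one ?_).1 (isEquivalent_descFactorial k)
    filter_upwards [eventually_gt_atTop 0] with d hd
    positivity
  have := (Complex.continuous_ofReal.tendsto _).comp h
  simpa [Function.comp_def] using this

theorem tendsto_coeff_rootSeries_scaledAppellPoly {f : ℂ → ℂ} (hf0 : f 0 = 1) (k : ℕ) :
    Tendsto (fun d => PowerSeries.coeff k (rootSeries (scaledAppellPoly f d).roots)) atTop
      (𝓝 (PowerSeries.coeff k (taylorSeries f))) := by
  have h := (tendsto_descFactorial_div_pow k).const_mul (PowerSeries.coeff k (taylorSeries f))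
  rw [mul_one] at h
  refine h.congr' ?_
  filter_upwards [eventually_ge_atTop (max k 1)] with d hd
  obtain ⟨hm, hn⟩ := monic_scaledAppellPoly hf0 d
  rw [coeff_rootSeries_roots hm (by omega), hn,
    coeff_scaledAppellPoly hf0 (by omega) (by omega)]

/-- The real parts of the roots of the scaled Appell polynomial; when these roots are real, they
are the roots themselves. -/
noncomputable def appellRoots (f : ℂ → ℂ) (d : ℕ) : Multiset ℝ :=
  (scaledAppellPoly f d).roots.map Complex.re

/-- The power sums of the roots of the scaled Appell polynomials converge to the moments of the
limit measure. -/
theorem LaguerrePolyaRep.tendsto_powerSum {ι : Type*} {f : ℂ → ℂ} {C c σ : ℝ} {m : ℕ} {x : ι → ℝ}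
    (hf : LaguerrePolyaRep f C c σ m x) (hf0 : f 0 = 1) (k : ℕ) :
    Tendsto (fun d => ((appellRoots f d).map fun t => t ^ (k + 2)).sum) atTop
      (𝓝 (σ ^ 2 * 0 ^ k + ∑' i, (x i)⁻¹ ^ (k + 2))) := by
  obtain ⟨H, hH, hcoeff⟩ := hf.exists_isLogDeriv hf0
  have hlim := IsLogDeriv.tendsto_logDeriv
    (fun d => isLogDeriv_rootSeries (scaledAppellPoly f d).roots) hH
    (fun d => coeff_zero_rootSeries _) (by rw [coeff_zero_taylorSeries, hf0])
    (tendsto_coeff_rootSeries_scaledAppellPoly hf0) (k + 1)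
  rw [hcoeff] at hlim
  have hre := ((Complex.continuous_re.tendsto _).comp hlim).neg
  simp only [Function.comp_def, Complex.neg_re, Complex.ofReal_re, neg_neg,
    PowerSeries.coeff_mk] at hre
  refine hre.congr fun d => ?_
  have hreal : ∀ r ∈ (scaledAppellPoly f d).roots, r.im = 0 := fun r hr =>
    realRooted_scaledAppellPoly hf0 (hf.preservesRealRoots hf0) d r (isRoot_of_mem_roots hr)
  rw [appellRoots, Multiset.map_map]
  generalize (scaledAppellPoly f d).roots = S at hreal
  induction S using Multiset.induction_on with
  | empty => simp
  | cons r S ih =>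
    rw [Multiset.map_cons, Multiset.sum_cons, Complex.add_re,
      ih fun r' hr' => hreal r' (by simp [hr']), Multiset.map_cons, Multiset.sum_cons]
    congr 1
    have hr : r = (r.re : ℂ) := Complex.ext rfl (by simp [hreal r (by simp)])
    rw [hr, Function.comp_apply, ← Complex.ofReal_pow, Complex.ofReal_re, Complex.ofReal_re]

/-! ### Convergence of measures from convergence of moments -/

theorem integrable_of_ae_mem_Icc {μ : Measure ℝ} [IsFiniteMeasure μ] {M : ℝ}
    (hM : ∀ᵐ t ∂μ, t ∈ Set.Icc (-M) M) {g : ℝ → ℝ} (hg : Continuous g) : Integrable g μ := by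
  obtain ⟨B, hB⟩ := isCompact_Icc.exists_bound_of_continuousOn
    (hg.continuousOn (s := Set.Icc (-M) M))
  exact Integrable.of_bound hg.aestronglyMeasurable B (hM.mono fun t ht => hB t ht)

theorem abs_integral_sub_integral_le_of_ae_mem_Icc {μ : Measure ℝ} [IsFiniteMeasure μ] {M ε : ℝ}
    (hM : ∀ᵐ t ∂μ, t ∈ Set.Icc (-M) M) {g : ℝ → ℝ} (hg : Continuous g) {q : ℝ → ℝ}
    (hq : Continuous q) (h : ∀ t ∈ Set.Icc (-M) M, |q t - g t| ≤ ε) :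
    |∫ t, q t ∂μ - ∫ t, g t ∂μ| ≤ ε * μ.real Set.univ := by
  rw [← integral_sub (integrable_of_ae_mem_Icc hM hq) (integrable_of_ae_mem_Icc hM hg),
    ← Real.norm_eq_abs]
  exact norm_integral_le_of_norm_le_const (hM.mono fun t ht => by
    rw [Real.norm_eq_abs]
    exact h t ht)

/-- The method of moments on a bounded interval: by the Weierstrass approximation theorem,
convergence of all moments implies convergence of the integrals of all continuous functions. -/
theorem tendsto_integral_of_tendsto_moments {ρ : ℕ → Measure ℝ} {G : Measure ℝ}
    [∀ d, IsFiniteMeasure (ρ d)] [IsFiniteMeasure G] {M : ℝ}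
    (hρ : ∀ d, ∀ᵐ t ∂ρ d, t ∈ Set.Icc (-M) M) (hG : ∀ᵐ t ∂G, t ∈ Set.Icc (-M) M)
    (hmom : ∀ k : ℕ, Tendsto (fun d => ∫ t, t ^ k ∂ρ d) atTop (𝓝 (∫ t, t ^ k ∂G)))
    {g : ℝ → ℝ} (hg : Continuous g) :
    Tendsto (fun d => ∫ t, g t ∂ρ d) atTop (𝓝 (∫ t, g t ∂G)) := by
  have hpoly : ∀ q : ℝ[X], Tendsto (fun d => ∫ t, q.eval t ∂ρ d) atTop
      (𝓝 (∫ t, q.eval t ∂G)) := by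
    intro q
    have key : ∀ {μ : Measure ℝ} [IsFiniteMeasure μ], (∀ᵐ t ∂μ, t ∈ Set.Icc (-M) M) →
        ∫ t, q.eval t ∂μ = ∑ k ∈ Finset.range (q.natDegree + 1), q.coeff k * ∫ t, t ^ k ∂μ := by
      intro μ _ hμ
      simp only [eval_eq_sum_range]
      rw [integral_finsetSum _ fun k _ => (integrable_of_ae_mem_Icc hμ (continuous_pow k)).const_mul _]
      simp only [integral_const_mul]
    rw [key hG]
    simp only [fun d => key (hρ d)]
    exact tendsto_finsetSum _ fun k _ => (hmom k).const_mul _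
  have hmass : ∀ᶠ d in atTop, (ρ d).real Set.univ < G.real Set.univ + 1 := by
    have h0 := hmom 0
    simp only [pow_zero, integral_const, smul_eq_mul, mul_one] at h0
    exact h0.eventually (gt_mem_nhds (lt_add_one _))
  rw [Metric.tendsto_nhds]
  intro ε hε
  have hK : 0 < G.real Set.univ + 1 := by positivity
  obtain ⟨q, hq⟩ := exists_polynomial_near_of_continuousOn (-M) M g hg.continuousOn
    (ε / 3 / (G.real Set.univ + 1)) (by positivity)
  have hev := (hpoly q).eventually (Metric.ball_mem_nhds _ (by positivity : 0 < ε / 3))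
  filter_upwards [hev, hmass] with d hd hdm
  have h1 := abs_integral_sub_integral_le_of_ae_mem_Icc (hρ d) hg q.continuous fun t ht => (hq t ht).le
  have h2 := abs_integral_sub_integral_le_of_ae_mem_Icc hG hg q.continuous fun t ht => (hq t ht).le
  have hδ : ε / 3 / (G.real Set.univ + 1) * (G.real Set.univ + 1) = ε / 3 :=
    div_mul_cancel₀ _ hK.ne'
  have h3 : ε / 3 / (G.real Set.univ + 1) * (ρ d).real Set.univ ≤ ε / 3 := by
    refine le_trans ?_ hδ.le
    gcongr
  have h4 : ε / 3 / (G.real Set.univ + 1) * G.real Set.univ ≤ ε / 3 := by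
    refine le_trans ?_ hδ.le
    gcongr
    linarith
  rw [Real.dist_eq] at hd
  rw [Real.dist_eq]
  have h5 := abs_le.1 h1
  have h6 := abs_le.1 h2
  have h7 := abs_lt.1 hd
  rw [abs_lt]
  constructor <;> linarith

/-! ### The root measures and the limit measure -/

/-- The measure `∑ t² δ_t`, over the elements `t` of a finite multiset. -/
noncomputable def squareAtoms (S : Multiset ℝ) : Measure ℝ :=
  (S.map fun t => ENNReal.ofReal (t ^ 2) • Measure.dirac t).sum

theorem squareAtoms_cons (t : ℝ) (S : Multiset ℝ) :
    squareAtoms (t ::ₘ S) = ENNReal.ofReal (t ^ 2) • Measure.dirac t + squareAtoms S := by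
  simp [squareAtoms]

instance (S : Multiset ℝ) : IsFiniteMeasure (squareAtoms S) := by
  induction S using Multiset.induction_on with
  | empty =>
    rw [squareAtoms, Multiset.map_zero, Multiset.sum_zero]
    infer_instance
  | cons t S ih =>
    rw [squareAtoms_cons]
    have := (Measure.dirac t).smul_finite (ENNReal.ofReal_ne_top (r := t ^ 2))
    infer_instance

theorem ae_squareAtoms {S : Multiset ℝ} {P : ℝ → Prop} (h : ∀ t ∈ S, P t) :
    ∀ᵐ t ∂squareAtoms S, P t := by
  induction S using Multiset.induction_on with
  | empty => simp [squareAtoms]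
  | cons t S ih =>
    rw [squareAtoms_cons, ae_add_measure_iff]
    refine ⟨Measure.ae_smul_measure ?_ _, ih fun t' ht' => h t' (by simp [ht'])⟩
    rw [ae_dirac_eq]
    exact h t (by simp)

theorem integral_squareAtoms (S : Multiset ℝ) {g : ℝ → ℝ} :
    Integrable g (squareAtoms S) ∧
      ∫ t, g t ∂squareAtoms S = (S.map fun t => t ^ 2 * g t).sum := by
  induction S using Multiset.induction_on with
  | empty => simp [squareAtoms]
  | cons t S ih =>
    have hi : Integrable g (ENNReal.ofReal (t ^ 2) • Measure.dirac t) :=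
      (integrable_dirac (by simp)).smul_measure ENNReal.ofReal_ne_top
    rw [squareAtoms_cons]
    refine ⟨hi.add_measure ih.1, ?_⟩
    rw [integral_add_measure hi ih.1, integral_smul_measure, integral_dirac, ih.2,
      ENNReal.toReal_ofReal (sq_nonneg t)]
    simp

theorem appellRootMeasure_eq_squareAtoms {f : ℂ → ℂ} (hf0 : f 0 = 1) (d : ℕ) :
    appellRootMeasure f d = squareAtoms (appellRoots f d) := by
  rw [appellRootMeasure, empiricalRootMeasure, (monic_scaledAppellPoly hf0 d).2, appellRoots]
  rcases eq_or_ne d 0 with rfl | hd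
  · simp [scaledAppellPoly_zero hf0, squareAtoms]
  have hd0 : (d : ℝ≥0∞) ≠ 0 := Nat.cast_ne_zero.2 hd
  rw [withDensity_smul_measure]
  generalize (scaledAppellPoly f d).roots = S
  induction S using Multiset.induction_on with
  | empty => simp [squareAtoms]
  | cons r S ih =>
    rw [Multiset.map_cons, Multiset.map_cons, Multiset.sum_cons, withDensity_add_measure,
      smul_add, ih, squareAtoms_cons, dirac_withDensity, smul_smul,
      ENNReal.ofReal_mul (Nat.cast_nonneg d), ENNReal.ofReal_natCast, ← mul_assoc,
      ENNReal.inv_mul_cancel hd0 (ENNReal.natCast_ne_top d), one_mul]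

section LimitMeasure

variable {ι : Type*} {x : ι → ℝ}

theorem isFiniteMeasure_limitRootMeasure (σ : ℝ) (hx : Summable fun i => ((x i) ^ 2)⁻¹) :
    IsFiniteMeasure (limitRootMeasure σ x) := by
  refine ⟨?_⟩
  rw [limitRootMeasure, Measure.add_apply, Measure.smul_apply,
    Measure.sum_apply _ MeasurableSet.univ]
  simp only [Measure.smul_apply, measure_univ, smul_eq_mul, mul_one]
  rw [← ENNReal.ofReal_tsum_of_nonneg (fun i => by positivity) hx]
  exact ENNReal.add_lt_top.2 ⟨ENNReal.ofReal_lt_top, ENNReal.ofReal_lt_top⟩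

theorem ae_limitRootMeasure [Countable ι] (σ : ℝ) {P : ℝ → Prop} (h0 : P 0) (h : ∀ i, P (x i)⁻¹) :
    ∀ᵐ t ∂limitRootMeasure σ x, P t := by
  rw [limitRootMeasure, ae_add_measure_iff, Measure.ae_sum_iff]
  refine ⟨Measure.ae_smul_measure ?_ _, fun i => Measure.ae_smul_measure ?_ _⟩
  · rw [ae_dirac_eq]
    exact h0
  · rw [ae_dirac_eq]
    exact h i

theorem integral_limitRootMeasure {σ : ℝ} {g : ℝ → ℝ} (hg : Integrable g (limitRootMeasure σ x)) :
    ∫ t, g t ∂limitRootMeasure σ x = σ ^ 2 * g 0 + ∑' i, ((x i) ^ 2)⁻¹ * g (x i)⁻¹ := by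
  rw [limitRootMeasure, integrable_add_measure] at hg
  rw [limitRootMeasure, integral_add_measure hg.1 hg.2, integral_sum_measure hg.2,
    integral_smul_measure, integral_dirac, ENNReal.toReal_ofReal (sq_nonneg σ)]
  simp only [integral_smul_measure, integral_dirac, smul_eq_mul]
  congr 2
  ext i
  rw [ENNReal.toReal_ofReal (by positivity)]

end LimitMeasure

theorem theorem2p2 {ι : Type*} [Countable ι] (f : ℂ → ℂ) (C c σ : ℝ) (m : ℕ) (x : ι → ℝ)
    (hf : LaguerrePolyaRep f C c σ m x) (hf0 : f 0 = 1) :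
    (∀ d : ℕ, ∀ z ∈ (scaledAppellPoly f d).roots, z.im = 0) ∧
      WeaklyConverges (appellRootMeasure f) (limitRootMeasure σ x) := by
  refine ⟨fun d z hz => realRooted_scaledAppellPoly hf0 (hf.preservesRealRoots hf0) d z
    (isRoot_of_mem_roots hz), ?_⟩
  have hρ : appellRootMeasure f = fun d => squareAtoms (appellRoots f d) :=
    funext fun d => appellRootMeasure_eq_squareAtoms hf0 d
  have hfin := isFiniteMeasure_limitRootMeasure σ hf.summable
  rw [hρ]
  refine ⟨fun d => inferInstance, hfin, fun g => ?_⟩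
  -- The second power sums are bounded, so all roots lie in one bounded interval.
  obtain ⟨B, hB⟩ := (hf.tendsto_powerSum hf0 0).bddAbove_range
  set M : ℝ := √(max B (∑' i, ((x i) ^ 2)⁻¹)) with hMdef
  have hmem : ∀ t : ℝ, t ^ 2 ≤ max B (∑' i, ((x i) ^ 2)⁻¹) → t ∈ Set.Icc (-M) M := fun t ht =>
    abs_le.1 (Real.abs_le_sqrt ht)
  have hroots : ∀ d, ∀ᵐ t ∂squareAtoms (appellRoots f d), t ∈ Set.Icc (-M) M := by
    intro d
    refine ae_squareAtoms fun t ht => hmem t (le_max_of_le_left ?_)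
    refine le_trans ?_ (hB (Set.mem_range_self d))
    refine Multiset.single_le_sum (fun u hu => ?_) _ (Multiset.mem_map_of_mem _ ht)
    obtain ⟨v, -, rfl⟩ := Multiset.mem_map.1 hu
    exact sq_nonneg v
  have hlimit : ∀ᵐ t ∂limitRootMeasure σ x, t ∈ Set.Icc (-M) M := by
    refine ae_limitRootMeasure σ (hmem 0 ?_) fun i => hmem _ (le_max_of_le_right ?_)
    · rw [zero_pow two_ne_zero]
      exact le_max_of_le_right (tsum_nonneg fun i => by positivity)
    · rw [inv_pow]
      exact hf.summable.le_tsum i fun j _ => by positivity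
  refine tendsto_integral_of_tendsto_moments hroots hlimit (fun k => ?_) g.continuous
  rw [integral_limitRootMeasure (integrable_of_ae_mem_Icc hlimit (continuous_pow k))]
  simp only [fun d => (integral_squareAtoms (appellRoots f d) (g := fun t => t ^ k)).2]
  have htsum : ∑' i, ((x i) ^ 2)⁻¹ * (x i)⁻¹ ^ k = ∑' i, (x i)⁻¹ ^ (k + 2) :=
    tsum_congr fun i => by rw [← inv_pow, ← pow_add, add_comm]
  rw [htsum]
  refine (hf.tendsto_powerSum hf0 k).congr fun d => ?_
  exact congrArg Multiset.sum (Multiset.map_congr rfl fun t _ => by ring)
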